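/- Let $n\ge 1$ and let $\Sigma_n$ be the group of permutations of $\{1,\dots,n\}$, acting on spaces and on complexes with the convention of the permutation action $g(x_1,\dots,x_n)=(x_{g(1)},\dots,x_{g(n)})$ on an $n$-fold product, that is, $g(hx)=(h\circ g)x$. Let $K$ be a finite simplicial $\Sigma_n$-complex (a finite simplicial complex with an action of $\Sigma_n$ on its vertices that sends simplexes to simplexes), let $L$ be any simplicial complex, and give the geometric realizations $|K|$, $|L|$ the coherent (weak) topology. Let $\operatorname{sd}^r(K)$ be the $r$-fold barycentric subdivision with the induced action, and identify $|\operatorname{sd}^r(K)|$ with $|K|$ by the canonical map. Let $I_n$ be the wedge of $n$ copies of $[0,1]$ at $0$, with $t_j$ the point $t$ of the $j$-th copy. Let $f_1,\dots,f_n:|K|\to|L|$ be continuous maps that are symmetrically homotopic: $f_j(gx)=f_{g(j)}(x)$, and there is a continuous $H:|K|\times I_n\to|L|$ with $H(x,1_j)=f_j(x)$ and $H(gx,t_j)=H(x,t_{g(j)})$ for all $g\in\Sigma_n$, $x\in|K|$, $t\in[0,1]$ and $1\le j\le n$. Then there are $r_0\in\mathbb N$ and simplicial maps $\varphi_1,\dots,\varphi_n:\operatorname{sd}^{r_0}(K)\to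 L$ such that each $\varphi_j$ is a simplicial approximation of $f_j$ (that is, $f_j(\operatorname{st}(v))\subseteq\operatorname{st}(\varphi_j(v))$ for every vertex $v$ of $\operatorname{sd}^{r_0}(K)$, where $\operatorname{st}$ denotes the open star) and $\varphi_1,\dots,\varphi_n$ are symmetrically contiguous: $\varphi_j(gv)=\varphi_{g(j)}(v)$, and there are a simplicial map $\varphi_*:\operatorname{sd}^{r_0}(K)\to L$ with $\varphi_*(gv)=\varphi_*(v)$, an integer $c\ge1$ and simplicial maps $\varphi_*=\varphi_j^0,\varphi_j^1,\dots,\varphi_j^c=\varphi_j$ from $\operatorname{sd}^{r_0}(K)$ to $L$ for $1\le j\le n$, such that $\varphi_j^{l-1}(\sigma)\cup\varphi_j^{l}(\sigma)$ is a simplex of $L$ for every simplex $\sigma$ of $\operatorname{sd}^{r_0}(K)$, and $\varphi_j^l(gv)=\varphi_{g(j)}^l(v)$, for all vertices $v$, $g\in\Sigma_n$, $1\le l\le c$ and $1\le j\le n$. -/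

import Mathlib

/-- A simplicial complex, bundled with its vertex set `V`: Mathlib's `AbstractSimplicialComplex V`
is a set of nonempty finite subsets of `V` that contains every singleton and every nonempty
subset of each of its members. -/
structure SimpCpx where
  V : Type*
  cx : AbstractSimplicialComplex V

namespace SimpCpx

/-- The simplexes of `K`. -/
def faces (K : SimpCpx) : Set (Finset K.V) := K.cx.faces

theorem nonempty_of_mem_faces (K : SimpCpx) {s : Finset K.V} (hs : s ∈ K.faces) : s.Nonempty :=
  (K.cx.isRelLowerSet_faces hs).1

theorem mem_faces_of_subset (K : SimpCpx) {s t : Finset K.V} (hs : s ∈ K.faces) (hts : t ⊆ s)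
    (ht : t.Nonempty) : t ∈ K.faces :=
  (K.cx.isRelLowerSet_faces hs).2 hts ht

/-- The geometric realization `|K|`: the functions `α : V → [0, 1]` whose support is a simplex
and whose values sum to `1`. (Supports are finite, so `α` is recorded as a finitely supported
function; `α v ≤ 1` follows from the other conditions.) -/
@[ext]
structure Realization (K : SimpCpx) where
  wt : K.V →₀ ℝ
  nonneg : ∀ v, 0 ≤ wt v
  total : wt.sum (fun _ a => a) = 1
  support_mem : wt.support ∈ K.faces

/-- The closed simplex `|σ|`: the points of `|K|` whose support is contained in `σ`. -/
def ClosedSimplex (K : SimpCpx) (s : Finset K.V) : Type _ :=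
  {x : K.Realization // x.wt.support ⊆ s}

/-- The inclusion of `|σ|` in `|K|`. -/
def ClosedSimplex.incl (K : SimpCpx) (s : Finset K.V) (x : K.ClosedSimplex s) : K.Realization :=
  x.1

/-- The Euclidean topology of a closed simplex, given by the weights as real coordinates. -/
instance (K : SimpCpx) (s : Finset K.V) : TopologicalSpace (K.ClosedSimplex s) :=
  TopologicalSpace.induced (fun x v => (ClosedSimplex.incl K s x).wt v)
    (inferInstance : TopologicalSpace (K.V → ℝ))

/-- The topology of `|K|` is the coherent (weak) topology: the finest topology for which the
inclusion of every closed simplex is continuous; so `U ⊆ |K|` is open if and only if `U ∩ |σ|` is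
open in `|σ|` for every simplex `σ`. -/
instance (K : SimpCpx) : TopologicalSpace K.Realization :=
  ⨆ s : K.faces, TopologicalSpace.coinduced (ClosedSimplex.incl K s.1) inferInstance

/-- The open star of a vertex. -/
def openStar (K : SimpCpx) (v : K.V) : Set K.Realization := {x | x.wt v ≠ 0}

/-- The barycentric subdivision: vertices are the simplexes of `K`, simplexes are the nonempty
finite chains of simplexes of `K` for inclusion. -/
def sd (K : SimpCpx) : SimpCpx where
  V := {s : Finset K.V // s ∈ K.faces}
  cx :=
    { faces := {c | c.Nonempty ∧ IsChain (fun a b : {s // s ∈ K.faces} => a.1 ⊆ b.1) c}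
      isRelLowerSet_faces := fun _ hc =>
        ⟨hc.1, fun _ hdc hd => ⟨hd, hc.2.mono fun _ ha => hdc ha⟩⟩
      singleton_mem := fun v => ⟨Finset.singleton_nonempty v, by simp⟩ }

/-- The simplex of `K` that a vertex of `sd K` is. -/
def sdVertex (K : SimpCpx) (s : K.sd.V) : Finset K.V := s.1

theorem sdVertex_mem (K : SimpCpx) (s : K.sd.V) : K.sdVertex s ∈ K.faces := s.2

theorem mem_faces_sd_iff (K : SimpCpx) (c : Finset K.sd.V) :
    c ∈ K.sd.faces ↔
      c.Nonempty ∧ IsChain (fun a b => K.sdVertex a ⊆ K.sdVertex b) (c : Set K.sd.V) :=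
  Iff.rfl

/-- The barycentre of a finite set `s` of vertices, with weight `1 / |s|` at each vertex. -/
noncomputable def barycentre (K : SimpCpx) (s : Finset K.V) : K.V →₀ ℝ :=
  Finsupp.indicator s (fun _ _ => (s.card : ℝ)⁻¹)

theorem barycentre_nonneg (K : SimpCpx) (s : Finset K.V) (v : K.V) : 0 ≤ K.barycentre s v := by
  classical
  rw [barycentre, Finsupp.indicator_apply]
  split_ifs <;> positivity

theorem barycentre_total (K : SimpCpx) {s : Finset K.V} (hs : s.Nonempty) :
    (K.barycentre s).sum (fun _ a => a) = 1 := by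
  classical
  rw [Finsupp.sum_of_support_subset (K.barycentre s) (s := s)
    (Finsupp.support_indicator_subset s _) _ (by simp)]
  rw [Finset.sum_congr rfl (g := fun _ => (s.card : ℝ)⁻¹)]
  · have : (s.card : ℝ) ≠ 0 := by exact_mod_cast hs.card_pos.ne'
    simp [this]
  · intro v hv
    rw [barycentre, Finsupp.indicator_of_mem hv]

/-- The weights of the image in `|K|` of a point of `|sd K|` with weights `w`: the combination
`∑ σ, w(σ) • barycentre σ`. -/
noncomputable def sdWeights (K : SimpCpx) (w : K.sd.V →₀ ℝ) : K.V →₀ ℝ :=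
  w.sum (fun s a => a • K.barycentre (K.sdVertex s))

theorem sdWeights_total (K : SimpCpx) (w : K.sd.V →₀ ℝ) :
    (K.sdWeights w).sum (fun _ a => a) = w.sum (fun _ a => a) := by
  rw [sdWeights, Finsupp.sum_sum_index (by simp) (by simp)]
  refine Finset.sum_congr rfl fun s _ => ?_
  change (w s • K.barycentre (K.sdVertex s)).sum (fun _ a => a) = w s
  rw [Finsupp.sum_smul_index (by simp), ← Finsupp.mul_sum,
    K.barycentre_total (K.nonempty_of_mem_faces (K.sdVertex_mem s)), mul_one]

/-- The canonical map `|sd K| → |K|`, affine on each simplex, that sends a vertex `σ` of `sd K`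
to the barycentre of `σ`. -/
noncomputable def sdMap (K : SimpCpx) (x : K.sd.Realization) : K.Realization where
  wt := K.sdWeights x.wt
  nonneg v := by
    rw [sdWeights, Finsupp.sum_apply]
    exact Finset.sum_nonneg fun s _ => mul_nonneg (x.nonneg s) (K.barycentre_nonneg _ v)
  total := (K.sdWeights_total x.wt).trans x.total
  support_mem := by
    classical
    obtain ⟨hne, hch⟩ := (K.mem_faces_sd_iff _).1 x.support_mem
    obtain ⟨m, hm, hmax⟩ :=
      Finset.exists_max_image x.wt.support (fun s => (K.sdVertex s).card) hne
    refine K.mem_faces_of_subset (K.sdVertex_mem m) (fun v hv => ?_) ?_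
    · rw [Finsupp.mem_support_iff, sdWeights, Finsupp.sum_apply] at hv
      obtain ⟨s, hs, hsv⟩ := Finset.exists_ne_zero_of_sum_ne_zero hv
      have hvs : v ∈ K.sdVertex s := by
        by_contra hvs
        exact hsv (by simp [barycentre, Finsupp.indicator_of_notMem hvs])
      rcases eq_or_ne s m with rfl | hsm
      · exact hvs
      · rcases hch hs hm hsm with h | h
        · exact h hvs
        · exact (Finset.eq_of_subset_of_card_le h (hmax s hs)) ▸ hvs
    · rw [Finset.nonempty_iff_ne_empty]
      intro h
      have htot := (K.sdWeights_total x.wt).trans x.total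
      rw [Finsupp.support_eq_empty.1 h] at htot
      simp at htot

end SimpCpx

open Classical in
/-- A simplicial map: a map of vertices that sends simplexes to simplexes. -/
structure SimpMap (K L : SimpCpx) where
  toFun : K.V → L.V
  map_face : ∀ s ∈ K.faces, s.image toFun ∈ L.faces

instance (K L : SimpCpx) : CoeFun (SimpMap K L) (fun _ => K.V → L.V) := ⟨SimpMap.toFun⟩

open Classical in
/-- `φ` and `ψ` are `1`-contiguous: `φ(σ) ∪ ψ(σ)` is a simplex for every simplex `σ`. -/
def Contiguous {K L : SimpCpx} (φ ψ : SimpMap K L) : Prop :=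
  ∀ s ∈ K.faces, s.image φ ∪ s.image ψ ∈ L.faces

/-- A simplicial `G`-complex: a simplicial complex with an action of `G` on the set of vertices
such that `{g • v : v ∈ σ}` is a simplex for every simplex `σ` and every `g`. -/
structure GSimpCpx (G : Type*) [Group G] extends SimpCpx where
  action : MulAction G V
  smul_face : ∀ (g : G), ∀ s ∈ cx.faces, s.map (MulAction.toPerm g).toEmbedding ∈ cx.faces

namespace GSimpCpx

variable {G : Type*} [Group G]

instance (K : GSimpCpx G) : MulAction G K.V := K.action

/-- The action of `G` on `|K|` that extends the action on the vertices affinely over the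
simplexes: `(g • x)(g • v) = x(v)`. -/
noncomputable instance (K : GSimpCpx G) : MulAction G K.Realization where
  smul g x :=
    { wt := x.wt.mapDomain (fun v => g • v)
      nonneg := fun v => by
        obtain ⟨w, rfl⟩ := MulAction.surjective g v
        rw [Finsupp.mapDomain_apply (MulAction.injective g)]
        exact x.nonneg w
      total := by
        rw [Finsupp.sum_mapDomain_index (by simp) (by simp)]
        exact x.total
      support_mem := by
        classical
        rw [Finsupp.mapDomain_support_of_injective (MulAction.injective g)]
        have h := K.smul_face g _ x.support_mem
        rw [Finset.map_eq_image] at h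
        exact h }
  one_smul x := by
    apply SimpCpx.Realization.ext
    change x.wt.mapDomain (fun v => (1 : G) • v) = x.wt
    simp only [one_smul]
    exact Finsupp.mapDomain_id
  mul_smul g h x := by
    apply SimpCpx.Realization.ext
    change x.wt.mapDomain (fun v => (g * h) • v) =
      (x.wt.mapDomain (fun v => h • v)).mapDomain (fun v => g • v)
    rw [← Finsupp.mapDomain_comp]
    congr 1
    funext v
    exact mul_smul g h v

/-- The barycentric subdivision of a simplicial `G`-complex, with the induced action
`g • {v₀, …, v_q} = {g • v₀, …, g • v_q}` on its vertices. -/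
def sd (K : GSimpCpx G) : GSimpCpx G where
  toSimpCpx := K.toSimpCpx.sd
  action :=
    { smul := fun g s => ⟨s.1.map (MulAction.toPerm g).toEmbedding, K.smul_face g s.1 s.2⟩
      one_smul := fun s => Subtype.ext (by
        change s.1.map (MulAction.toPerm (1 : G)).toEmbedding = s.1
        ext v
        simp)
      mul_smul := fun g h s => Subtype.ext (by
        change s.1.map (MulAction.toPerm (g * h)).toEmbedding =
          (s.1.map (MulAction.toPerm h).toEmbedding).map (MulAction.toPerm g).toEmbedding
        ext v
        simp [mul_smul]) }
  smul_face := by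
    rintro g c ⟨hne, hch⟩
    refine ⟨hne.map, ?_⟩
    intro a' ha' b' hb' hab
    obtain ⟨a, ha, rfl⟩ := Finset.mem_map.1 (Finset.mem_coe.1 ha')
    obtain ⟨b, hb, rfl⟩ := Finset.mem_map.1 (Finset.mem_coe.1 hb')
    have hne : a ≠ b := fun h => hab (by rw [h])
    rcases hch (Finset.mem_coe.2 ha) (Finset.mem_coe.2 hb) hne with h | h
    · exact Or.inl (Finset.map_subset_map.2 h)
    · exact Or.inr (Finset.map_subset_map.2 h)

/-- The iterated barycentric subdivision: `sd⁰ K = K` and `sdʳ⁺¹ K = sd (sdʳ K)`. -/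
def iterSd (K : GSimpCpx G) : ℕ → GSimpCpx G
  | 0 => K
  | r + 1 => (K.iterSd r).sd

/-- The canonical map `|sdʳ K| → |K|`. -/
noncomputable def iterSdMap (K : GSimpCpx G) :
    (r : ℕ) → (K.iterSd r).Realization → K.Realization
  | 0 => id
  | r + 1 => fun x => K.iterSdMap r ((K.iterSd r).toSimpCpx.sdMap x)

/-- `φ : sdʳ K → L` is a simplicial approximation of `f : |K| → |L|`: under the canonical
identification of `|sdʳ K|` with `|K|`, `f(st v) ⊆ st (φ v)` for every vertex `v` of `sdʳ K`. -/
def IsSimplicialApprox (K : GSimpCpx G) {L : SimpCpx} {r : ℕ}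
    (φ : SimpMap (K.iterSd r).toSimpCpx L) (f : K.Realization → L.Realization) : Prop :=
  ∀ v : (K.iterSd r).V,
    f '' (K.iterSdMap r '' (K.iterSd r).openStar v) ⊆ L.openStar (φ v)

end GSimpCpx

/-- The group acting on `Σ_n`-spaces and `Σ_n`-complexes. Permutations act by
`g(x₁, …, xₙ) = (x_{g(1)}, …, x_{g(n)})`, which satisfies `g(h x) = (h ∘ g) x`; so an action of
`Σ_n` is a left action of the opposite group, `g x` being `MulOpposite.op g • x`. -/
abbrev SymGroup (n : ℕ) : Type := (Equiv.Perm (Fin n))ᵐᵒᵖ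

/-- Identification of all the points `0_j = (j, 0)`. -/
def wedgeSetoid (n : ℕ) : Setoid (Fin n × unitInterval) where
  r p q := p = q ∨ (p.2 = 0 ∧ q.2 = 0)
  iseqv :=
    { refl := fun _ => Or.inl rfl
      symm := by
        rintro p q (h | h)
        · exact Or.inl h.symm
        · exact Or.inr h.symm
      trans := by
        rintro p q s (rfl | h) (rfl | h')
        · exact Or.inl rfl
        · exact Or.inr h'
        · exact Or.inr h
        · exact Or.inr ⟨h.1, h'.2⟩ }

/-- The wedge `I_n` of `n` unit intervals at `0`, with the quotient topology. -/
def WedgeInterval (n : ℕ) : Type := Quotient (wedgeSetoid n)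

instance (n : ℕ) : TopologicalSpace (WedgeInterval n) :=
  inferInstanceAs (TopologicalSpace (Quotient (wedgeSetoid n)))

/-- The point `t_j` of the `j`-th interval of `I_n`. -/
def WedgeInterval.pt {n : ℕ} (t : unitInterval) (j : Fin n) : WedgeInterval n :=
  Quotient.mk (wedgeSetoid n) (j, t)

/-- Maps `f₁, …, fₙ : X → Y` on a `Σ_n`-space `X` are symmetrically homotopic. -/
def SymmetricallyHomotopic {n : ℕ} {X Y : Type*} [TopologicalSpace X] [TopologicalSpace Y]
    [MulAction (SymGroup n) X] (f : Fin n → C(X, Y)) : Prop :=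
  (∀ (g : Equiv.Perm (Fin n)) (j : Fin n) (x : X), f j (MulOpposite.op g • x) = f (g j) x) ∧
  ∃ H : C(X × WedgeInterval n, Y),
    (∀ (j : Fin n) (x : X), H (x, WedgeInterval.pt 1 j) = f j x) ∧
    (∀ (g : Equiv.Perm (Fin n)) (x : X) (t : unitInterval) (j : Fin n),
      H (MulOpposite.op g • x, WedgeInterval.pt t j) = H (x, WedgeInterval.pt t (g j)))

/-- Simplicial maps `φ₁, …, φₙ : K → L` on a simplicial `Σ_n`-complex `K` are symmetrically
contiguous: there are an invariant simplicial map `φs` and chains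
`φs = Φ j 0, Φ j 1, …, Φ j c = φ j` of `1`-contiguous simplicial maps (the values `Φ j l` for
`l > c` play no role) with the same symmetry as the `φ j`. -/
def SymmetricallyContiguous {n : ℕ} {K : GSimpCpx (SymGroup n)} {L : SimpCpx}
    (φ : Fin n → SimpMap K.toSimpCpx L) : Prop :=
  (∀ (g : Equiv.Perm (Fin n)) (j : Fin n) (v : K.V),
    φ j (MulOpposite.op g • v) = φ (g j) v) ∧
  ∃ (φs : SimpMap K.toSimpCpx L) (c : ℕ) (Φ : Fin n → ℕ → SimpMap K.toSimpCpx L),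
    0 < c ∧
    (∀ (g : Equiv.Perm (Fin n)) (v : K.V), φs (MulOpposite.op g • v) = φs v) ∧
    (∀ j, Φ j 0 = φs) ∧
    (∀ j, Φ j c = φ j) ∧
    (∀ j, ∀ l < c, Contiguous (Φ j l) (Φ j (l + 1))) ∧
    (∀ (g : Equiv.Perm (Fin n)) (j : Fin n) (l : ℕ) (v : K.V), 1 ≤ l → l ≤ c →
      Φ j l (MulOpposite.op g • v) = Φ (g j) l v)

/-! By compactness of `|K| × [0, 1]`, a Lebesgue number argument on each leg of the wedge gives one
`m` such that `H` sends every product of the open star of a vertex of `sdᵐ K` with a time interval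
`[l/m, (l+1)/m]` into a single open star of `L`. Choosing a vertex of `L` with such a star gives
vertex maps `ψ l j` that approximate `H` at every time of the `l`-th interval. Neighbouring
intervals share an endpoint, and two approximations of one map are contiguous
(`image_union_image_mem_faces`), so these maps form the chains, and the last one approximates `f j`.

Symmetry costs nothing because the vertex is chosen as a function of the image set alone
(`starVertex_congr`), and equivariance makes the image sets for `(g v, j)` and `(v, g j)` equal
(`starImage_smul`). At time `0` the legs meet, so the choice made there is invariant. -/

open Topology Filter

/-! ### Topology of the realization and open stars. -/

namespace SimpCpx

theorem mem_openStar (K : SimpCpx) {v : K.V} {x : K.Realization} :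
    x ∈ K.openStar v ↔ x.wt v ≠ 0 :=
  Iff.rfl

theorem continuous_wt_apply (K : SimpCpx) (v : K.V) :
    Continuous fun x : K.Realization => x.wt v := by
  refine continuous_iSup_dom.2 fun s => continuous_coinduced_dom.2 ?_
  exact (continuous_apply v).comp continuous_induced_dom

theorem isOpen_openStar (K : SimpCpx) (v : K.V) : IsOpen (K.openStar v) :=
  isOpen_ne.preimage (K.continuous_wt_apply v)

theorem exists_mem_openStar (K : SimpCpx) (x : K.Realization) : ∃ v, x ∈ K.openStar v := by
  obtain ⟨v, hv⟩ := K.nonempty_of_mem_faces x.support_mem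
  exact ⟨v, Finsupp.mem_support_iff.1 hv⟩

theorem continuous_incl (K : SimpCpx) {s : Finset K.V} (hs : s ∈ K.faces) :
    Continuous (ClosedSimplex.incl K s) := by
  rw [continuous_iff_coinduced_le]
  exact le_iSup (fun s : K.faces => TopologicalSpace.coinduced (ClosedSimplex.incl K s.1)
    inferInstance) ⟨s, hs⟩

theorem compactSpace_closedSimplex (K : SimpCpx) [Finite K.V] {s : Finset K.V}
    (hs : s ∈ K.faces) : CompactSpace (K.ClosedSimplex s) := by
  have := Fintype.ofFinite K.V
  let e : K.ClosedSimplex s → K.V → ℝ := fun x v => (ClosedSimplex.incl K s x).wt v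
  have he : IsInducing e := ⟨rfl⟩
  have hrange : Set.range e = stdSimplex ℝ K.V ∩ ⋂ v ∈ (sᶜ : Set K.V), {w | w v = 0} := by
    ext w
    simp only [Set.mem_range, Set.mem_inter_iff, Set.mem_iInter, Set.mem_compl_iff,
      Finset.mem_coe, Set.mem_ofPred_eq]
    constructor
    · rintro ⟨x, rfl⟩
      refine ⟨⟨x.1.nonneg, ?_⟩, fun v hv => ?_⟩
      · have := x.1.total
        rwa [Finsupp.sum_fintype _ _ (by simp)] at this
      · by_contra h
        exact hv (x.2 (Finsupp.mem_support_iff.2 h))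
    · rintro ⟨⟨h0, h1⟩, h2⟩
      let w' : K.V →₀ ℝ := Finsupp.equivFunOnFinite.symm w
      have hsub : w'.support ⊆ s := fun v hv => by
        by_contra h
        exact Finsupp.mem_support_iff.1 hv (h2 v h)
      have htot : w'.sum (fun _ a => a) = 1 := by
        rw [Finsupp.sum_fintype _ _ (by simp)]
        exact h1
      refine ⟨⟨⟨w', h0, htot, K.mem_faces_of_subset hs hsub ?_⟩, hsub⟩, rfl⟩
      rw [Finset.nonempty_iff_ne_empty]
      intro h
      rw [Finsupp.support_eq_empty.1 h] at htot
      simp at htot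
  refine ⟨he.isCompact_iff.2 ?_⟩
  rw [Set.image_univ, hrange]
  refine (isCompact_stdSimplex ℝ K.V).inter_right (isClosed_biInter fun v _ => ?_)
  exact isClosed_eq (continuous_apply v) continuous_const

instance compactSpace_realization (K : SimpCpx) [Finite K.V] : CompactSpace K.Realization := by
  have := Fintype.ofFinite K.V
  have : Finite K.faces := inferInstance
  refine ⟨?_⟩
  have h : (Set.univ : Set K.Realization) = ⋃ s : K.faces, Set.range (ClosedSimplex.incl K s.1) := by
    symm
    rw [Set.eq_univ_iff_forall]
    exact fun x => Set.mem_iUnion.2 ⟨⟨_, x.support_mem⟩, ⟨x, subset_rfl⟩, rfl⟩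
  rw [h]
  refine isCompact_iUnion fun s => ?_
  have := K.compactSpace_closedSimplex s.2
  exact isCompact_range (K.continuous_incl s.2)

/-- A continuous injection of a compact space into a Hausdorff one. Hence for finite `K` the
coherent topology is that of the coordinates, and is metrizable. -/
theorem isClosedEmbedding_wt (K : SimpCpx) [Finite K.V] :
    IsClosedEmbedding fun (x : K.Realization) v => x.wt v :=
  (continuous_pi K.continuous_wt_apply).isClosedEmbedding fun _ _ h =>
    Realization.ext (DFunLike.coe_injective h)

/-- The barycentre of a simplex, as a point of the realization. -/
noncomputable def barycentrePoint (K : SimpCpx) {s : Finset K.V} (hs : s ∈ K.faces) :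
    K.Realization where
  wt := K.barycentre s
  nonneg := K.barycentre_nonneg s
  total := K.barycentre_total (K.nonempty_of_mem_faces hs)
  support_mem := by
    refine K.mem_faces_of_subset hs (Finsupp.support_indicator_subset s _) ?_
    rw [Finset.nonempty_iff_ne_empty]
    intro h
    have htot := K.barycentre_total (K.nonempty_of_mem_faces hs)
    rw [Finsupp.support_eq_empty.1 h] at htot
    simp at htot

theorem barycentrePoint_mem_openStar (K : SimpCpx) {s : Finset K.V} (hs : s ∈ K.faces) {v : K.V}
    (hv : v ∈ s) : K.barycentrePoint hs ∈ K.openStar v := by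
  change K.barycentre s v ≠ 0
  rw [barycentre, Finsupp.indicator_of_mem hv]
  have : 0 < s.card := Finset.card_pos.2 ⟨v, hv⟩
  positivity

theorem singleton_mem_faces (K : SimpCpx) (v : K.V) : {v} ∈ K.faces :=
  K.cx.singleton_mem v

open Classical in
/-- If `h` sends the open star of `v` into the open stars of `φ v` and `ψ v` for every vertex `v`,
then `φ` and `ψ` send each simplex into a common simplex. -/
theorem image_union_image_mem_faces {K L : SimpCpx} (h : K.Realization → L.Realization)
    (φ ψ : K.V → L.V) (hφ : ∀ v, Set.MapsTo h (K.openStar v) (L.openStar (φ v)))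
    (hψ : ∀ v, Set.MapsTo h (K.openStar v) (L.openStar (ψ v))) {s : Finset K.V}
    (hs : s ∈ K.faces) : s.image φ ∪ s.image ψ ∈ L.faces := by
  -- The barycentre of `s` lies in the open star of every vertex of `s`, so the support of its image
  -- contains all the `φ v` and `ψ v`.
  refine L.mem_faces_of_subset (h (K.barycentrePoint hs)).support_mem ?_ ?_
  · refine Finset.union_subset ?_ ?_ <;>
    · refine Finset.image_subset_iff.2 fun v hv => Finsupp.mem_support_iff.2 ?_
      first
        | exact hφ v (K.barycentrePoint_mem_openStar hs hv)
        | exact hψ v (K.barycentrePoint_mem_openStar hs hv)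
  · exact ((K.nonempty_of_mem_faces hs).image φ).mono Finset.subset_union_left

/-! ### Mesh of the subdivision, through oscillations of affine functions. -/

/-- The function on the realization that is affine on simplexes with vertex values `β`. -/
noncomputable def affineExt (K : SimpCpx) (β : K.V → ℝ) (x : K.Realization) : ℝ :=
  x.wt.sum fun v a => a * β v

/-- The values at the barycentres of the affine extension of `β`. -/
noncomputable def sdValues (K : SimpCpx) (β : K.V → ℝ) (s : K.sd.V) : ℝ :=
  ((K.sdVertex s).card : ℝ)⁻¹ * ∑ v ∈ K.sdVertex s, β v

theorem affineExt_sdMap (K : SimpCpx) (β : K.V → ℝ) (x : K.sd.Realization) :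
    K.affineExt β (K.sdMap x) = K.sd.affineExt (K.sdValues β) x := by
  change (x.wt.sum fun s a => a • K.barycentre (K.sdVertex s)).sum (fun v a => a * β v) = _
  rw [Finsupp.sum_sum_index (by simp) (by intros; ring)]
  refine Finset.sum_congr rfl fun s _ => ?_
  change (x.wt s • K.barycentre (K.sdVertex s)).sum (fun v a => a * β v) = x.wt s * K.sdValues β s
  rw [Finsupp.sum_smul_index (by simp),
    Finsupp.sum_of_support_subset (K.barycentre (K.sdVertex s)) (s := K.sdVertex s)
      (Finsupp.support_indicator_subset _ _) _ (by simp),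
    sdValues, Finset.mul_sum, Finset.mul_sum]
  refine Finset.sum_congr rfl fun v hv => ?_
  rw [barycentre, Finsupp.indicator_of_mem hv, mul_assoc]

open Classical in
theorem affineExt_ite (K : SimpCpx) (u : K.V) (x : K.Realization) :
    K.affineExt (fun v => if v = u then 1 else 0) x = x.wt u := by
  simp only [affineExt, mul_ite, mul_one, mul_zero]
  exact Finsupp.sum_ite_self_eq' x.wt u

theorem abs_affineExt_sub_le (K : SimpCpx) (β : K.V → ℝ) {D : ℝ}
    (hβ : ∀ s ∈ K.faces, ∀ v ∈ s, ∀ w ∈ s, |β v - β w| ≤ D) {x : K.Realization} {v : K.V}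
    (hx : x ∈ K.openStar v) : |K.affineExt β x - β v| ≤ D := by
  have h1 : ∑ u ∈ x.wt.support, x.wt u = 1 := x.total
  have h2 : K.affineExt β x - β v = ∑ u ∈ x.wt.support, x.wt u * (β u - β v) := by
    simp only [mul_sub, Finset.sum_sub_distrib, ← Finset.sum_mul, h1, one_mul]
    rfl
  calc |K.affineExt β x - β v| ≤ ∑ u ∈ x.wt.support, |x.wt u * (β u - β v)| := by
        rw [h2]; exact Finset.abs_sum_le_sum_abs _ _
    _ ≤ ∑ u ∈ x.wt.support, x.wt u * D := by
        refine Finset.sum_le_sum fun u hu => ?_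
        rw [abs_mul, abs_of_nonneg (x.nonneg u)]
        exact mul_le_mul_of_nonneg_left
          (hβ _ x.support_mem u hu v (Finsupp.mem_support_iff.2 hx)) (x.nonneg u)
    _ = D := by rw [← Finset.sum_mul, h1, one_mul]

/-- Cardinality is injective on a chain, with values in `{1, …, N}`. So one contraction factor
serves for all iterated subdivisions. -/
theorem card_le_of_mem_faces_sd (K : SimpCpx) {N : ℕ} (hN : ∀ s ∈ K.faces, s.card ≤ N)
    {c : Finset K.sd.V} (hc : c ∈ K.sd.faces) : c.card ≤ N := by
  have hch := ((K.mem_faces_sd_iff c).1 hc).2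
  rw [← Nat.card_Icc 1 N |>.trans (Nat.add_sub_cancel N 1)]
  refine Finset.card_le_card_of_injOn (fun s => (K.sdVertex s).card) (fun s _ => ?_) ?_
  · exact Finset.mem_coe.2 (Finset.mem_Icc.2 ⟨(K.nonempty_of_mem_faces (K.sdVertex_mem s)).card_pos,
      hN _ (K.sdVertex_mem s)⟩)
  · intro a ha b hb hab
    by_contra hne
    rcases hch ha hb hne with h | h
    · exact hne (Subtype.ext (Finset.eq_of_subset_of_card_le h hab.ge))
    · exact hne (Subtype.ext (Finset.eq_of_subset_of_card_le h hab.le).symm)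

/-- In the average of `β u - β w` over `w` the term `w = u` vanishes, which saves a fraction `1 /
card` of `D`. -/
theorem abs_sub_sdValues_le (K : SimpCpx) (β : K.V → ℝ) {N : ℕ} {D : ℝ}
    {t : K.sd.V} (ht : (K.sdVertex t).card ≤ N)
    (hβ : ∀ v ∈ K.sdVertex t, ∀ w ∈ K.sdVertex t, |β v - β w| ≤ D)
    {u : K.V} (hu : u ∈ K.sdVertex t) : |β u - K.sdValues β t| ≤ (1 - (N : ℝ)⁻¹) * D := by
  classical
  have hpos : (0 : ℝ) < (K.sdVertex t).card := by exact_mod_cast Finset.card_pos.2 ⟨u, hu⟩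
  have hle : ((K.sdVertex t).card : ℝ) ≤ N := by exact_mod_cast ht
  have hD : 0 ≤ D := (abs_nonneg _).trans (hβ u hu u hu)
  have h1 : β u - K.sdValues β t =
      ((K.sdVertex t).card : ℝ)⁻¹ * ∑ w ∈ K.sdVertex t, (β u - β w) := by
    rw [sdValues, Finset.sum_sub_distrib, Finset.sum_const, nsmul_eq_mul, mul_sub,
      inv_mul_cancel_left₀ hpos.ne']
  have h2 : |∑ w ∈ K.sdVertex t, (β u - β w)| ≤ ((K.sdVertex t).card - 1) * D := by
    rw [← Finset.add_sum_erase _ _ hu, sub_self, zero_add]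
    calc _ ≤ ∑ w ∈ (K.sdVertex t).erase u, |β u - β w| := Finset.abs_sum_le_sum_abs _ _
      _ ≤ ∑ w ∈ (K.sdVertex t).erase u, D :=
        Finset.sum_le_sum fun w hw => hβ u hu w (Finset.mem_of_mem_erase hw)
      _ = _ := by
        rw [Finset.sum_const, nsmul_eq_mul, Finset.card_erase_of_mem hu,
          Nat.cast_pred (Finset.card_pos.2 ⟨u, hu⟩)]
  rw [h1, abs_mul, abs_of_pos (inv_pos.2 hpos)]
  calc _ ≤ ((K.sdVertex t).card : ℝ)⁻¹ * (((K.sdVertex t).card - 1) * D) :=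
        mul_le_mul_of_nonneg_left h2 (inv_pos.2 hpos).le
    _ = (1 - ((K.sdVertex t).card : ℝ)⁻¹) * D := by field_simp
    _ ≤ _ := by gcongr

/-- Of two members of a chain one contains the other. The value at the smaller averages values at
vertices of the larger, each close to the larger's own average. -/
theorem abs_sdValues_sub_le (K : SimpCpx) (β : K.V → ℝ) {N : ℕ} {D : ℝ}
    (hN : ∀ s ∈ K.faces, s.card ≤ N)
    (hβ : ∀ s ∈ K.faces, ∀ v ∈ s, ∀ w ∈ s, |β v - β w| ≤ D) {c : Finset K.sd.V}
    (hc : c ∈ K.sd.faces) {s t : K.sd.V} (hs : s ∈ c) (ht : t ∈ c) :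
    |K.sdValues β s - K.sdValues β t| ≤ (1 - (N : ℝ)⁻¹) * D := by
  have key : ∀ s t : K.sd.V, K.sdVertex s ⊆ K.sdVertex t →
      |K.sdValues β s - K.sdValues β t| ≤ (1 - (N : ℝ)⁻¹) * D := by
    intro s t hst
    have hpos : (0 : ℝ) < (K.sdVertex s).card := by
      exact_mod_cast (K.nonempty_of_mem_faces (K.sdVertex_mem s)).card_pos
    have h1 : K.sdValues β s - K.sdValues β t =
        ((K.sdVertex s).card : ℝ)⁻¹ * ∑ v ∈ K.sdVertex s, (β v - K.sdValues β t) := by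
      rw [Finset.sum_sub_distrib, Finset.sum_const, nsmul_eq_mul, mul_sub,
        inv_mul_cancel_left₀ hpos.ne', sdValues]
    rw [h1, abs_mul, abs_of_pos (inv_pos.2 hpos), inv_mul_le_iff₀ hpos]
    refine (Finset.abs_sum_le_sum_abs _ _).trans ?_
    rw [← nsmul_eq_mul, ← Finset.sum_const]
    exact Finset.sum_le_sum fun v hv => K.abs_sub_sdValues_le β (hN _ (K.sdVertex_mem t))
      (hβ _ (K.sdVertex_mem t)) (hst hv)
  by_cases hst : s = t
  · subst hst
    obtain ⟨v, hv⟩ := K.nonempty_of_mem_faces (K.sdVertex_mem s)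
    exact key s s subset_rfl
  rcases ((K.mem_faces_sd_iff c).1 hc).2 hs ht hst with h | h
  · exact key s t h
  · rw [abs_sub_comm]
    exact key t s h

end SimpCpx

/-! ### Equivariance, and fineness of iterated subdivisions. -/

namespace GSimpCpx

variable {G : Type*} [Group G]

theorem smul_wt_apply (K : GSimpCpx G) (g : G) (x : K.Realization) (v : K.V) :
    (g • x).wt (g • v) = x.wt v :=
  Finsupp.mapDomain_apply (MulAction.injective g) x.wt v

theorem smul_mem_openStar_iff (K : GSimpCpx G) (g : G) (x : K.Realization) (v : K.V) :
    g • x ∈ K.openStar (g • v) ↔ x ∈ K.openStar v := by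
  rw [SimpCpx.mem_openStar, SimpCpx.mem_openStar, K.smul_wt_apply]

theorem barycentre_smul (K : GSimpCpx G) (g : G) (s : K.sd.V) :
    K.barycentre (K.sdVertex (g • s)) =
      (K.barycentre (K.sdVertex s)).mapDomain (fun v => g • v) := by
  classical
  ext v
  obtain ⟨w, rfl⟩ := MulAction.surjective g v
  rw [Finsupp.mapDomain_apply (MulAction.injective g)]
  have h : K.sdVertex (g • s) = (K.sdVertex s).map (MulAction.toPerm g).toEmbedding := rfl
  have hw : g • w ∈ K.sdVertex (g • s) ↔ w ∈ K.sdVertex s := by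
    rw [h]
    simp
  rw [SimpCpx.barycentre, SimpCpx.barycentre, Finsupp.indicator_apply, Finsupp.indicator_apply]
  have hc : (K.sdVertex (g • s)).card = (K.sdVertex s).card := Finset.card_map _
  simp only [hw, hc]

theorem sdMap_smul (K : GSimpCpx G) (g : G) (x : K.sd.Realization) :
    K.toSimpCpx.sdMap (g • x) = (g • K.toSimpCpx.sdMap x : K.Realization) := by
  apply SimpCpx.Realization.ext
  change (x.wt.mapDomain (fun s => g • s)).sum (fun s a => a • K.barycentre (K.sdVertex s)) =
    (x.wt.sum (fun s a => a • K.barycentre (K.sdVertex s))).mapDomain (fun v => g • v)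
  rw [Finsupp.sum_mapDomain_index (by simp) (by intros; rw [add_smul])]
  refine Eq.trans ?_ (map_sum (Finsupp.mapDomain.addMonoidHom fun v : K.V => g • v)
    (fun s => x.wt s • K.barycentre (K.sdVertex s)) x.wt.support).symm
  refine Finset.sum_congr rfl fun s _ => ?_
  exact (congrArg _ (K.barycentre_smul g s)).trans (Finsupp.mapDomain_smul _ _).symm

theorem iterSdMap_smul (K : GSimpCpx G) (g : G) :
    ∀ (r : ℕ) (x : (K.iterSd r).Realization), K.iterSdMap r (g • x) = g • K.iterSdMap r x
  | 0, _ => rfl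
  | r + 1, x => by
    exact (congrArg _ ((K.iterSd r).sdMap_smul g x)).trans (iterSdMap_smul K g r _)

theorem card_le_of_mem_faces_iterSd (K : GSimpCpx G) {N : ℕ} (hN : ∀ s ∈ K.faces, s.card ≤ N) :
    ∀ r, ∀ s ∈ (K.iterSd r).faces, s.card ≤ N
  | 0 => hN
  | r + 1 => fun _ hs =>
    (K.iterSd r).card_le_of_mem_faces_sd (card_le_of_mem_faces_iterSd K hN r) hs

/-- Each coordinate of `|K|` stays affine on the simplexes of every subdivision, so its oscillation
can be followed on vertices alone, gaining one factor per step. -/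
theorem exists_values_iterSd (K : GSimpCpx G) {N : ℕ} (hN : ∀ s ∈ K.faces, s.card ≤ N)
    (u : K.V) : ∀ r, ∃ β : (K.iterSd r).V → ℝ,
      (∀ x, (K.iterSdMap r x).wt u = (K.iterSd r).affineExt β x) ∧
      ∀ s ∈ (K.iterSd r).faces, ∀ v ∈ s, ∀ w ∈ s, |β v - β w| ≤ (1 - (N : ℝ)⁻¹) ^ r
  | 0 => by
    classical
    refine ⟨fun v => if v = u then 1 else 0, fun x => ?_, fun s _ v _ w _ => ?_⟩
    · exact (K.affineExt_ite u x).symm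
    · simp only [pow_zero]
      split_ifs <;> norm_num
  | r + 1 => by
    obtain ⟨β, h1, h2⟩ := exists_values_iterSd K hN u r
    refine ⟨(K.iterSd r).sdValues β, fun x => ?_, fun c hc s hs t ht => ?_⟩
    · exact (h1 _).trans ((K.iterSd r).affineExt_sdMap β x)
    · rw [pow_succ']
      exact (K.iterSd r).abs_sdValues_sub_le β (K.card_le_of_mem_faces_iterSd hN r) h2 hc hs ht

theorem abs_iterSdMap_sub_le (K : GSimpCpx G) {N : ℕ} (hN : ∀ s ∈ K.faces, s.card ≤ N) (r : ℕ)
    {v : (K.iterSd r).V} {x y : (K.iterSd r).Realization} (hx : x ∈ (K.iterSd r).openStar v)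
    (hy : y ∈ (K.iterSd r).openStar v) (u : K.V) :
    |(K.iterSdMap r x).wt u - (K.iterSdMap r y).wt u| ≤ 2 * (1 - (N : ℝ)⁻¹) ^ r := by
  obtain ⟨β, h1, h2⟩ := K.exists_values_iterSd hN u r
  have hx' := (K.iterSd r).abs_affineExt_sub_le β h2 hx
  have hy' := (K.iterSd r).abs_affineExt_sub_le β h2 hy
  rw [h1, h1]
  rw [abs_le] at *
  constructor <;> linarith

/-- For all large `m`, a continuous map on `|K| × [0, 1]` sends each product of the open star of a
vertex of `sdᵐ K` with an interval `[l / m, (l + 1) / m]` into an open star. -/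
theorem eventually_exists_mapsTo_openStar (K : GSimpCpx G) [Finite K.V] {L : SimpCpx}
    (h : C(K.Realization × unitInterval, L.Realization)) :
    ∀ᶠ m : ℕ in atTop, ∀ (v : (K.iterSd m).V) (l : ℕ), l < m → ∃ w, ∀ x ∈ (K.iterSd m).openStar v,
      ∀ t : unitInterval, (l : ℝ) / m ≤ t → (t : ℝ) ≤ (l + 1) / m →
        h (K.iterSdMap m x, t) ∈ L.openStar w := by
  have := Fintype.ofFinite K.V
  -- The sup metric of the coordinates, inducing the given topology.
  let _ : MetricSpace K.Realization := K.isClosedEmbedding_wt.isEmbedding.comapMetricSpace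
  obtain ⟨δ, hδ, hball⟩ := lebesgue_number_lemma_of_metric (s := Set.univ)
    (c := fun w : L.V => h ⁻¹' L.openStar w) isCompact_univ
    (fun w => (L.isOpen_openStar w).preimage h.continuous)
    (fun p _ => Set.mem_iUnion.2 (L.exists_mem_openStar (h p)))
  -- The `+ 1` keeps `N` positive when there are no vertices.
  set N := Fintype.card K.V + 1
  have hN : ∀ s ∈ K.faces, s.card ≤ N := fun s _ => s.card_le_univ.trans (Nat.le_succ _)
  have hq : Tendsto (fun r : ℕ => 2 * (1 - (N : ℝ)⁻¹) ^ r) atTop (𝓝 0) := by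
    have hN1 : (1 : ℝ) ≤ N := by exact_mod_cast Nat.succ_le_succ (Nat.zero_le _)
    have hpos : 0 < (N : ℝ)⁻¹ := by positivity
    have hle : (N : ℝ)⁻¹ ≤ 1 := inv_le_one_of_one_le₀ hN1
    simpa using (tendsto_pow_atTop_nhds_zero_of_lt_one (sub_nonneg.2 hle)
      (sub_lt_self 1 hpos)).const_mul 2
  filter_upwards [hq.eventually (gt_mem_nhds hδ),
    tendsto_one_div_atTop_nhds_zero_nat.eventually (gt_mem_nhds hδ), eventually_gt_atTop 0]
    with m hm1 hm2 hm0 v l hl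
  have hm0' : (0 : ℝ) < m := by exact_mod_cast hm0
  have hl' : (l : ℝ) + 1 ≤ m := by exact_mod_cast hl
  let t₀ : unitInterval := ⟨l / m, by positivity, by rw [div_le_one hm0']; linarith⟩
  let x₀ := (K.iterSd m).barycentrePoint ((K.iterSd m).singleton_mem_faces v)
  have hx₀ : x₀ ∈ (K.iterSd m).openStar v :=
    (K.iterSd m).barycentrePoint_mem_openStar _ (Finset.mem_singleton_self v)
  obtain ⟨w, hw⟩ := hball (K.iterSdMap m x₀, t₀) trivial
  refine ⟨w, fun x hx t ht1 ht2 => hw ?_⟩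
  rw [Metric.mem_ball, Prod.dist_eq, max_lt_iff]
  constructor
  · change dist (fun v => (K.iterSdMap m x).wt v) (fun v => (K.iterSdMap m x₀).wt v) < δ
    refine (dist_pi_lt_iff hδ).2 fun u => ?_
    rw [Real.dist_eq]
    exact (K.abs_iterSdMap_sub_le hN m hx hx₀ u).trans_lt hm1
  · change dist (t : ℝ) (l / m) < δ
    rw [Real.dist_eq, abs_of_nonneg (by linarith)]
    rw [add_div] at ht2
    linarith

end GSimpCpx

/-! ### Choice of vertices depending only on image sets. -/

namespace SimpCpx

/-- A vertex whose open star contains `A`. -/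
noncomputable def starVertex (L : SimpCpx) (A : Set L.Realization)
    (h : ∃ w, A ⊆ L.openStar w) : L.V :=
  h.choose

theorem subset_openStar_starVertex (L : SimpCpx) (A : Set L.Realization)
    (h : ∃ w, A ⊆ L.openStar w) : A ⊆ L.openStar (L.starVertex A h) :=
  h.choose_spec

/-- This turns equalities of image sets into the symmetry of the chosen vertex maps, with no choice
of orbit representatives. -/
theorem starVertex_congr (L : SimpCpx) {A B : Set L.Realization} (hAB : A = B)
    (hA : ∃ w, A ⊆ L.openStar w) (hB : ∃ w, B ⊆ L.openStar w) :
    L.starVertex A hA = L.starVertex B hB := by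
  subst hAB
  rfl

end SimpCpx

/-- The simplicial map given by a vertex map that approximates some map of realizations. -/
def SimpMap.ofMapsTo {K L : SimpCpx} (h : K.Realization → L.Realization) (φ : K.V → L.V)
    (hφ : ∀ v, Set.MapsTo h (K.openStar v) (L.openStar (φ v))) : SimpMap K L where
  toFun := φ
  map_face s hs := by
    classical
    convert SimpCpx.image_union_image_mem_faces h φ φ hφ hφ hs
    rw [Finset.union_self]

theorem WedgeInterval.pt_zero {n : ℕ} (i j : Fin n) :
    (WedgeInterval.pt 0 i : WedgeInterval n) = WedgeInterval.pt 0 j :=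
  Quotient.sound (Or.inr ⟨rfl, rfl⟩)

theorem WedgeInterval.continuous_pt {n : ℕ} (j : Fin n) :
    Continuous fun t : unitInterval => (WedgeInterval.pt t j : WedgeInterval n) :=
  continuous_quot_mk.comp (Continuous.prodMk_right j)

namespace GSimpCpx

/-- The image of `st v × T`, with `v` a vertex of `sdʳ K` and `T` in the `j`-th interval of the
wedge, under a map on `|K| × I_n`. -/
def starImage {n : ℕ} (K : GSimpCpx (SymGroup n)) {Y : Type*}
    (H : K.Realization × WedgeInterval n → Y) (r : ℕ) (T : Set unitInterval) (j : Fin n)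
    (v : (K.iterSd r).V) : Set Y :=
  {y | ∃ x ∈ (K.iterSd r).openStar v, ∃ t ∈ T, H (K.iterSdMap r x, WedgeInterval.pt t j) = y}

/-- The action of `g` is a bijection from the open star of `v` to that of `g v`, and commutes with
the canonical map. -/
theorem starImage_smul {n : ℕ} (K : GSimpCpx (SymGroup n)) {Y : Type*}
    (H : K.Realization × WedgeInterval n → Y)
    (hH : ∀ (g : Equiv.Perm (Fin n)) (x : K.Realization) (t : unitInterval) (j : Fin n),
      H (MulOpposite.op g • x, WedgeInterval.pt t j) = H (x, WedgeInterval.pt t (g j)))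
    (r : ℕ) (T : Set unitInterval) (g : Equiv.Perm (Fin n)) (j : Fin n) (v : (K.iterSd r).V) :
    K.starImage H r T j (MulOpposite.op g • v) = K.starImage H r T (g j) v := by
  ext y
  constructor
  · rintro ⟨x, hx, t, ht, rfl⟩
    obtain ⟨x, rfl⟩ := MulAction.surjective (MulOpposite.op g) x
    refine ⟨x, ((K.iterSd r).smul_mem_openStar_iff _ x v).1 hx, t, ht, ?_⟩
    rw [iterSdMap_smul, hH]
  · rintro ⟨x, hx, t, ht, rfl⟩
    refine ⟨MulOpposite.op g • x, ((K.iterSd r).smul_mem_openStar_iff _ x v).2 hx, t, ht, ?_⟩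
    rw [iterSdMap_smul, hH]

end GSimpCpx

/-! ### Assembly of the symmetric chains. -/

theorem mainTheorem4 {n : ℕ} (hn : 1 ≤ n) (K : GSimpCpx (SymGroup n)) [Finite K.V] (L : SimpCpx)
    (f : Fin n → C(K.Realization, L.Realization)) (hf : SymmetricallyHomotopic f) :
    ∃ (r₀ : ℕ) (φ : Fin n → SimpMap (K.iterSd r₀).toSimpCpx L),
      (∀ j, K.IsSimplicialApprox (φ j) (f j)) ∧ SymmetricallyContiguous φ := by
  obtain ⟨-, H, hH1, hH⟩ := hf
  have hev := (eventually_all.2 fun j : Fin n => K.eventually_exists_mapsTo_openStar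
    (H.comp ⟨fun p : K.Realization × unitInterval => (p.1, WedgeInterval.pt p.2 j),
      continuous_fst.prodMk ((WedgeInterval.continuous_pt j).comp continuous_snd)⟩)).and
    (eventually_gt_atTop 0)
  obtain ⟨m, hm, hm0⟩ := hev.exists
  have hm0' : (0 : ℝ) < m := by exact_mod_cast hm0
  let T : ℕ → Set unitInterval := fun l => {t | (l : ℝ) / m ≤ t ∧ (t : ℝ) ≤ (l + 1) / m}
  have hT : ∀ l < m, ∀ j v, ∃ w, K.starImage H m (T l) j v ⊆ L.openStar w := by
    intro l hl j v
    obtain ⟨w, hw⟩ := hm j v l hl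
    refine ⟨w, ?_⟩
    rintro _ ⟨x, hx, t, ht, rfl⟩
    exact hw x hx t ht.1 ht.2
  have h0T : (0 : unitInterval) ∈ T 0 := ⟨by simp, by simp⟩
  have hT0 : ∀ j v, ∃ w, K.starImage H m {0} j v ⊆ L.openStar w := by
    intro j v
    obtain ⟨w, hw⟩ := hT 0 hm0 j v
    refine ⟨w, ?_⟩
    rintro _ ⟨x, hx, _, rfl, rfl⟩
    exact hw ⟨x, hx, 0, h0T, rfl⟩
  let j₀ : Fin n := ⟨0, hn⟩
  let h (t : unitInterval) (j : Fin n) (x : (K.iterSd m).Realization) : L.Realization :=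
    H (K.iterSdMap m x, WedgeInterval.pt t j)
  let ψ (l : ℕ) (hl : l < m) (j : Fin n) (v : (K.iterSd m).V) : L.V :=
    L.starVertex (K.starImage H m (T l) j v) (hT l hl j v)
  have hψ : ∀ l (hl : l < m) j, ∀ t ∈ T l, ∀ v,
      Set.MapsTo (h t j) ((K.iterSd m).openStar v) (L.openStar (ψ l hl j v)) :=
    fun l hl j t ht v x hx => L.subset_openStar_starVertex _ (hT l hl j v) ⟨x, hx, t, ht, rfl⟩
  -- The time set is `{0}` and not `T 0`: only at the wedge point is the image independent of the
  -- leg.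
  let ψ₀ (v : (K.iterSd m).V) : L.V := L.starVertex (K.starImage H m {0} j₀ v) (hT0 j₀ v)
  have hψ₀ : ∀ v, Set.MapsTo (h 0 j₀) ((K.iterSd m).openStar v) (L.openStar (ψ₀ v)) :=
    fun v x hx => L.subset_openStar_starVertex _ (hT0 j₀ v) ⟨x, hx, 0, rfl, rfl⟩
  have hh0 : ∀ i j, h 0 i = h 0 j := fun i j => by
    funext x
    change H (_, _) = H (_, _)
    rw [WedgeInterval.pt_zero i j]
  let left (l : ℕ) (hl : l < m) : unitInterval := ⟨l / m, by positivity, by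
    rw [div_le_one hm0']; exact_mod_cast hl.le⟩
  have hleft : ∀ l (hl : l < m), left l hl ∈ T l := fun l hl =>
    ⟨le_rfl, by change (l : ℝ) / m ≤ _; gcongr; linarith⟩
  -- The endpoint shared by `T l` and `T (l + 1)`, where both vertex maps approximate the same map.
  have hleft' : ∀ l (hl : l + 1 < m), left (l + 1) hl ∈ T l := fun l hl =>
    ⟨by change (l : ℝ) / m ≤ (l + 1 : ℕ) / m; gcongr; simp,
      by change ((l + 1 : ℕ) : ℝ) / m ≤ (l + 1) / m; simp⟩
  have h1T : (1 : unitInterval) ∈ T (m - 1) := by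
    have hc : ((m - 1 : ℕ) : ℝ) = m - 1 := Nat.cast_pred hm0
    refine ⟨?_, ?_⟩
    · change _ ≤ (1 : ℝ)
      rw [hc, div_le_one hm0']
      linarith
    · change (1 : ℝ) ≤ _
      rw [hc, sub_add_cancel, div_self hm0'.ne']
  let φs : SimpMap (K.iterSd m).toSimpCpx L := SimpMap.ofMapsTo (h 0 j₀) ψ₀ hψ₀
  let Ψ (l : ℕ) (hl : l < m) (j : Fin n) : SimpMap (K.iterSd m).toSimpCpx L :=
    SimpMap.ofMapsTo _ (ψ l hl j) (hψ l hl j _ (hleft l hl))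
  have hψg : ∀ l (hl : l < m) (g : Equiv.Perm (Fin n)) j v,
      ψ l hl j (MulOpposite.op g • v) = ψ l hl (g j) v := fun l hl g j v =>
    L.starVertex_congr (K.starImage_smul H hH m (T l) g j v) _ _
  -- Index `0` is the invariant map, so interval `l` sits at index `l + 1` and the chain has length
  -- `m`; beyond that, `φs` is filler.
  let Φ (j : Fin n) : ℕ → SimpMap (K.iterSd m).toSimpCpx L
    | 0 => φs
    | l + 1 => if hl : l < m then Ψ l hl j else φs
  have hΦ : ∀ j l (hl : l < m), Φ j (l + 1) = Ψ l hl j := fun j l hl => dif_pos hl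
  have hm1 : m - 1 < m := Nat.sub_lt hm0 one_pos
  refine ⟨m, Ψ (m - 1) hm1, fun j v => ?_, hψg _ hm1, φs, m, Φ, hm0, fun g v => ?_,
    fun j => rfl, fun j => ?_, fun j l hl s hs => ?_, fun g j l v hl1 hl2 => ?_⟩
  · rintro _ ⟨_, ⟨x, hx, rfl⟩, rfl⟩
    rw [← hH1]
    exact hψ (m - 1) hm1 j 1 h1T v hx
  -- Acting by `g` replaces leg `j₀` by leg `g j₀`, which has the same point at time `0`.
  · refine L.starVertex_congr ?_ _ _
    rw [K.starImage_smul H hH]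
    ext y
    simp only [GSimpCpx.starImage, Set.mem_singleton_iff, exists_eq_left,
      WedgeInterval.pt_zero (g j₀) j₀]
  · obtain ⟨k, rfl⟩ : ∃ k, m = k + 1 := ⟨m - 1, by omega⟩
    exact hΦ j k (Nat.lt_succ_self k)
  · rw [hΦ j l hl]
    cases l with
    | zero =>
      exact SimpCpx.image_union_image_mem_faces (h 0 j₀) ψ₀ (ψ 0 hl j) hψ₀
        (hh0 j j₀ ▸ hψ 0 hl j 0 h0T) hs
    | succ l =>
      have hl' : l < m := by omega
      rw [hΦ j l hl']
      exact SimpCpx.image_union_image_mem_faces (h (left (l + 1) hl) j) (ψ l hl' j)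
        (ψ (l + 1) hl j) (hψ l hl' j _ (hleft' l hl)) (hψ (l + 1) hl j _ (hleft (l + 1) hl)) hs
  · obtain ⟨k, rfl⟩ : ∃ k, l = k + 1 := ⟨l - 1, by omega⟩
    have hk : k < m := by omega
    rw [hΦ j k hk, hΦ (g j) k hk]
    exact hψg k hk g j v
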